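/- **Setting.** Let $\overline{\mathcal B}$ be the space of barcodes: multisets of intervals $[a,b)$, $0\le a<b<\infty$, having for every $\epsilon>0$ only finitely many members (counted with multiplicity) of length more than $\epsilon$. It carries the bottleneck metric $$d_{\mathcal B}(A,B)=\inf_{C}\ \sup_{(I,J)\in C} d_\infty(I,J),$$ where $C$ runs over the matchings of $A$ with $B$ (a bijection between a sub-multiset of $A$ and a sub-multiset of $B$, all remaining intervals being matched with $\emptyset$), $d_\infty([a,b),[a',b'))=\max(|a-a'|,|b-b'|)$ and $d_\infty([a,b),\emptyset)=d_\infty(\emptyset,[a,b))=(b-a)/2$. Borel probability measures on $\overline{\mathcal B}$ carry the Prohorov metric $d_{Pr}$. Fix a coefficient field $F$, $k\ge 0$ and a closed set $S\subseteq[0,\infty)$ of scales. For a non-empty finite metric space $Y$ let $\mathrm{PH}_k(Y)\in\overline{\mathcal B}$ be the barcode of the $k$-th persistent homology (reduced, with coefficients in $F$) of the Vietoris–Rips complexes $\mathrm{VR}_\epsilon(Y)$, $\epsilon\ge 0$ (a non-empty finite set is a simplex of $\mathrm{VR}_\epsilon(Y)$ when its points have pairwise distance at most $\epsilon$), observed at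 the scales in $S$: at scale $t$ one uses $\mathrm{VR}_s(Y)$ for the last $s\in S$ with $s\le t$ (the empty complex if there is none), and if $S$ is bounded all bars are cut off at its largest element (if $S=\emptyset$, there are no bars). For $S=[0,\infty)$ this is the full Vietoris–Rips filtration; $S=[0,T]$ gives the filtration with cut-off at $T$, and a finite $S$ gives a fixed finite sequence of scales. For $n\ge 1$ and a non-empty finite metric space $X$ with its uniform probability measure $\mu_X$, let $\Phi_k^n(X)=(\mathrm{PH}_k)_*(\mu_X^{\otimes n})$, the distribution on $\overline{\mathcal B}$ of $\mathrm{PH}_k(\{x_1,\dots,x_n\})$ for $(x_1,\dots,x_n)\in X^n$ distributed according to $\mu_X^{\otimes n}$, where $\{x_1,\dots,x_n\}$ has the metric of $X$. For a Borel probability measure $\mathcal P$ on $\overline{\mathcal B}$ let $\mathrm{HD}_k^n(X,\mathcal P)=d_{Pr}(\Phi_k^n(X),\mathcal P)$. A function $f$ from non-empty finite metric spaces to a metric space $(B,d)$ is *uniformly robust* with robustness coefficient $r>0$ and estimate bound $\delta$ if for every non-empty finite metric space $X$ and every isometric embedding of $X$ into a finite metric space $X'$, $|X'|/|X|<1+r$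 implies $d(f(X),f(X'))<\delta$. **Theorem.** Let $k\ge 0$ and $n\ge 1$. For every $r>0$, the function $\Phi_k^n$, with values in the Borel probability measures on $\overline{\mathcal B}$ with the metric $d_{Pr}$, is uniformly robust with robustness coefficient $r$ and estimate bound $nr/(1+r)$. For every $r>0$ and every Borel probability measure $\mathcal P$ on $\overline{\mathcal B}$, the function $\mathrm{HD}_k^n(-,\mathcal P)$, with values in $\mathbb R$, is uniformly robust with robustness coefficient $r$ and estimate bound $nr/(1+r)$. -/

import Mathlib

open MeasureTheory
open scoped NNReal ENNReal

noncomputable section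

/-! ### Barcodes and the bottleneck metric -/

/-- The set of intervals `[a, b)` with `0 ≤ a < b < ∞`, encoded by the pairs `(a, b)`.
As a subspace of `ℝ × ℝ` it carries the sup distance `max |a₁ - a₂| |b₁ - b₂|`. -/
abbrev BarInterval : Type := {p : ℝ × ℝ // 0 ≤ p.1 ∧ p.1 < p.2}

namespace BarInterval

/-- The left end point of the interval. -/
def birth (I : BarInterval) : ℝ := I.1.1

/-- The right end point of the interval. -/
def death (I : BarInterval) : ℝ := I.1.2

/-- The length `b - a` of `[a, b)`. -/
def length (I : BarInterval) : ℝ := I.death - I.birth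

lemma length_pos (I : BarInterval) : 0 < I.length := sub_pos.2 I.2.2

lemma length_le (I J : BarInterval) : I.length ≤ 2 * dist I J + J.length := by
  have h1 : |I.1.1 - J.1.1| ≤ dist I J := by
    rw [Subtype.dist_eq, Prod.dist_eq, ← Real.dist_eq]; exact le_max_left _ _
  have h2 : |I.1.2 - J.1.2| ≤ dist I J := by
    rw [Subtype.dist_eq, Prod.dist_eq, ← Real.dist_eq]; exact le_max_right _ _
  have h3 := abs_le.1 h1
  have h4 := abs_le.1 h2
  simp only [length, birth, death]
  linarith [h3.1, h4.2]

/-- The distance `(b - a) / 2` from the interval `[a, b)` to the empty interval. -/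
def halfLength (I : BarInterval) : ℝ≥0∞ := ENNReal.ofReal (I.length / 2)

lemma halfLength_le (I J : BarInterval) : I.halfLength ≤ edist I J + J.halfLength := by
  have hJ := J.length_pos
  rw [halfLength, halfLength, edist_dist, ← ENNReal.ofReal_add dist_nonneg (by linarith)]
  exact ENNReal.ofReal_le_ofReal (by linarith [length_le I J])

end BarInterval

/-- The space of barcodes: multisets of intervals `[a, b)`, `0 ≤ a < b < ∞`, given by their
multiplicity functions, such that for every `ε > 0` only finitely many members (counted with
multiplicity) are longer than `ε`. -/
@[ext] structure Barcode where
  /-- The multiplicity of an interval. -/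
  mult : BarInterval → ℕ
  finite_long : ∀ ε : ℝ, 0 < ε → {I : BarInterval | ε < I.length ∧ mult I ≠ 0}.Finite

namespace Barcode

instance : Inhabited Barcode := ⟨⟨fun _ => 0, by simp⟩⟩

/-- The bars of `A`: each interval `I` is listed `A.mult I` times. -/
abbrev Bars (A : Barcode) : Type := Σ I : BarInterval, Fin (A.mult I)

/-- The cost of a matching. A matching between `A` and `B` is a bijection between a part of the
bars of `A` and a part of the bars of `B`; all other bars are matched with the empty interval.
The cost is the largest distance between matched partners. -/
def matchingCost {A B : Barcode} (γ : A.Bars ≃. B.Bars) : ℝ≥0∞ :=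
  (⨆ (i : A.Bars) (j : B.Bars) (_ : γ i = some j), edist i.1 j.1) ⊔
    (⨆ (i : A.Bars) (_ : γ i = none), i.1.halfLength) ⊔
    (⨆ (j : B.Bars) (_ : γ.symm j = none), j.1.halfLength)

lemma matchingCost_le_iff {A B : Barcode} (γ : A.Bars ≃. B.Bars) (c : ℝ≥0∞) :
    matchingCost γ ≤ c ↔ (∀ i j, γ i = some j → edist i.1 j.1 ≤ c) ∧
      (∀ i, γ i = none → i.1.halfLength ≤ c) ∧ ∀ j, γ.symm j = none → j.1.halfLength ≤ c := by
  simp only [matchingCost, sup_le_iff, iSup_le_iff, and_assoc]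

/-- The bottleneck distance: the infimum of the costs of all matchings. -/
def bottleneckDist (A B : Barcode) : ℝ≥0∞ := ⨅ γ : A.Bars ≃. B.Bars, matchingCost γ

lemma bottleneckDist_self (A : Barcode) : bottleneckDist A A = 0 := by
  refine le_antisymm (iInf_le_of_le (PEquiv.refl _) ?_) bot_le
  rw [matchingCost_le_iff]
  refine ⟨fun i j h => ?_, fun i h => ?_, fun j h => ?_⟩
  · rw [PEquiv.refl_apply, Option.some.injEq] at h
    simp [h]
  · simp at h
  · simp at h

lemma bottleneckDist_le_swap (A B : Barcode) : bottleneckDist A B ≤ bottleneckDist B A := by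
  refine le_iInf fun γ => iInf_le_of_le γ.symm ?_
  obtain ⟨h1, h2, h3⟩ := (matchingCost_le_iff γ _).1 le_rfl
  rw [matchingCost_le_iff]
  refine ⟨fun i j h => ?_, h3, by simpa using h2⟩
  rw [edist_comm]
  exact h1 _ _ (γ.eq_some_iff.1 h)

lemma bottleneckDist_triangle (A B C : Barcode) :
    bottleneckDist A C ≤ bottleneckDist A B + bottleneckDist B C := by
  refine ENNReal.le_iInf_add_iInf fun γ η => iInf_le_of_le (γ.trans η) ?_
  obtain ⟨g1, g2, g3⟩ := (matchingCost_le_iff γ _).1 le_rfl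
  obtain ⟨h1, h2, h3⟩ := (matchingCost_le_iff η _).1 le_rfl
  rw [matchingCost_le_iff]
  refine ⟨fun i j h => ?_, fun i h => ?_, fun j h => ?_⟩
  · obtain ⟨m, hm, hj⟩ := PEquiv.mem_trans γ η i j |>.1 h
    exact (edist_triangle _ m.1 _).trans (add_le_add (g1 _ _ hm) (h1 _ _ hj))
  · rcases hi : γ i with _ | m
    · exact (g2 i hi).trans le_self_add
    · have hm : η m = none := by
        rcases hm : η m with _ | j
        · rfl
        · have := (PEquiv.mem_trans γ η i j).2 ⟨m, hi, hm⟩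
          rw [Option.mem_def, h] at this
          exact absurd this (by simp)
      exact (BarInterval.halfLength_le _ m.1).trans (add_le_add (g1 _ _ hi) (h2 _ hm))
  · rcases hj : η.symm j with _ | m
    · exact (h3 j hj).trans le_add_self
    · have hm : γ.symm m = none := by
        rcases hm : γ.symm m with _ | i
        · rfl
        · have := (PEquiv.mem_trans γ η i j).2 ⟨m, γ.eq_some_iff.1 hm, η.eq_some_iff.1 hj⟩
          rw [Option.mem_def, ← PEquiv.eq_some_iff, h] at this
          exact absurd this (by simp)
      have := add_le_add (g3 _ hm) (h1 _ _ (η.eq_some_iff.1 hj))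
      refine (BarInterval.halfLength_le _ m.1).trans ?_
      rw [add_comm, edist_comm]
      exact this

lemma exists_halfLength_le (A : Barcode) :
    ∃ c : ℝ, ∀ i : A.Bars, i.1.halfLength ≤ ENNReal.ofReal c := by
  obtain ⟨c, hc⟩ := ((A.finite_long 1 one_pos).image BarInterval.length).bddAbove
  refine ⟨max 1 c, fun i => ENNReal.ofReal_le_ofReal ?_⟩
  have hpos := i.1.length_pos
  by_cases h : 1 < i.1.length
  · have : i.1.length ≤ c := hc ⟨i.1, ⟨h, fun h0 => (h0 ▸ i.2).elim0⟩, rfl⟩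
    exact le_trans (by linarith) (le_max_right _ _)
  · exact le_trans (by linarith) (le_max_left _ _)

lemma bottleneckDist_ne_top (A B : Barcode) : bottleneckDist A B ≠ ∞ := by
  obtain ⟨a, ha⟩ := exists_halfLength_le A
  obtain ⟨b, hb⟩ := exists_halfLength_le B
  refine ne_top_of_le_ne_top (b := max (ENNReal.ofReal a) (ENNReal.ofReal b)) (by simp)
    (iInf_le_of_le ⊥ ?_)
  rw [matchingCost_le_iff]
  exact ⟨fun i j h => by simp at h, fun i _ => (ha i).trans (le_max_left _ _),
    fun j _ => (hb j).trans (le_max_right _ _)⟩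

lemma mult_le_of_bottleneckDist_eq_zero {A B : Barcode} (h : bottleneckDist A B = 0)
    (I : BarInterval) : A.mult I ≤ B.mult I := by
  have hI := I.length_pos
  -- the intervals of `B` longer than half of `I`, other than `I`, stay away from `I`
  have hfin : {J : BarInterval | I.length / 2 < J.length ∧ B.mult J ≠ 0}.Finite :=
    B.finite_long _ (by linarith)
  obtain ⟨δ, hδ, hsep⟩ : ∃ δ : ℝ, 0 < δ ∧ ∀ J : BarInterval,
      I.length / 2 < J.length → B.mult J ≠ 0 → J ≠ I → δ ≤ dist I J := by
    have hev : ∀ᶠ δ : ℝ in nhdsWithin 0 (Set.Ioi 0), ∀ J ∈ hfin.toFinset, J ≠ I → δ ≤ dist I J := by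
      rw [Filter.eventually_all_finset]
      intro J _
      by_cases hJ : J = I
      · exact Filter.Eventually.of_forall fun _ h => absurd hJ h
      · have : 0 < dist I J := dist_pos.2 (Ne.symm hJ)
        filter_upwards [Ioo_mem_nhdsGT this] with δ hδ _ using hδ.2.le
    obtain ⟨δ, h1, h2⟩ := (hev.and self_mem_nhdsWithin).exists
    exact ⟨δ, h2, fun J hJ hB hne => h1 J (by simpa using ⟨hJ, hB⟩) hne⟩
  set c : ℝ := min δ (I.length / 4) with hc
  have hcpos : 0 < c := lt_min hδ (by linarith)
  obtain ⟨γ, hγ⟩ : ∃ γ : A.Bars ≃. B.Bars, matchingCost γ < ENNReal.ofReal c := by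
    rw [← iInf_lt_iff]
    change bottleneckDist A B < _
    rw [h]; simpa using hcpos
  obtain ⟨g1, g2, -⟩ := (matchingCost_le_iff γ _).1 le_rfl
  have key : ∀ i : Fin (A.mult I), ∃ j : Fin (B.mult I), γ ⟨I, i⟩ = some ⟨I, j⟩ := by
    intro i
    rcases hi : γ ⟨I, i⟩ with _ | ⟨J, j⟩
    · have := (g2 _ hi).trans_lt hγ
      rw [BarInterval.halfLength, ENNReal.ofReal_lt_ofReal_iff hcpos] at this
      have := min_le_right δ (I.length / 4)
      simp only at *
      linarith
    · have hlt := (g1 _ _ hi).trans_lt hγ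
      rw [edist_dist, ENNReal.ofReal_lt_ofReal_iff hcpos] at hlt
      simp only at hlt
      have h4 := min_le_right δ (I.length / 4)
      have h5 := BarInterval.length_le I J
      have hJ : J = I := by
        by_contra hne
        have := hsep J (by linarith) (fun h0 => (h0 ▸ j).elim0) hne
        have := min_le_left δ (I.length / 4)
        linarith
      subst hJ
      exact ⟨j, rfl⟩
  choose f hf using key
  have hinj : Function.Injective f := by
    intro i j hij
    have h1 := γ.eq_some_iff.2 (hf i)
    have h2 := γ.eq_some_iff.2 (hf j)
    rw [hij, h2] at h1
    simpa using h1.symm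
  simpa using Fintype.card_le_of_injective f hinj

/-- The bottleneck metric. -/
instance : MetricSpace Barcode :=
  letI : EMetricSpace Barcode :=
    { edist := bottleneckDist
      edist_self := bottleneckDist_self
      edist_comm := fun A B => le_antisymm (bottleneckDist_le_swap A B) (bottleneckDist_le_swap B A)
      edist_triangle := bottleneckDist_triangle
      eq_of_edist_eq_zero := fun {A B} h => Barcode.ext <| funext fun I =>
        le_antisymm (mult_le_of_bottleneckDist_eq_zero h I)
          (mult_le_of_bottleneckDist_eq_zero
            (le_antisymm ((bottleneckDist_le_swap B A).trans h.le) bot_le) I) }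
  EMetricSpace.toMetricSpace bottleneckDist_ne_top

lemma edist_eq (A B : Barcode) : edist A B = bottleneckDist A B := rfl

instance : MeasurableSpace Barcode := borel Barcode

instance : BorelSpace Barcode := ⟨rfl⟩

end Barcode

/-! ### Persistence modules and their barcodes -/

/-- A persistence module over `F`, indexed by the scales in `[0, ∞)`. -/
structure PersistenceModule.{u, v} (F : Type u) [Field F] where
  obj : ℝ≥0 → Type v
  [addCommGroup : ∀ t, AddCommGroup (obj t)]
  [module : ∀ t, Module F (obj t)]
  map : ∀ {s t : ℝ≥0}, s ≤ t → obj s →ₗ[F] obj t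
  map_refl : ∀ (t : ℝ≥0) (x : obj t), map le_rfl x = x
  map_map : ∀ {s t u : ℝ≥0} (hst : s ≤ t) (htu : t ≤ u) (x : obj s),
    map htu (map hst x) = map (hst.trans htu) x

namespace PersistenceModule

attribute [instance] addCommGroup module

variable {F : Type*} [Field F]

/-- An isomorphism of persistence modules. -/
structure Iso (M N : PersistenceModule F) where
  equiv : ∀ t, M.obj t ≃ₗ[F] N.obj t
  comm : ∀ {s t : ℝ≥0} (h : s ≤ t) (x : M.obj s), equiv t (M.map h x) = N.map h (equiv s x)

/-- The bars of `A` that contain `t`. -/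
def liveBars (A : Barcode) (t : ℝ≥0) : Set A.Bars := {i | i.1.birth ≤ t ∧ t < i.1.death}

/-- The direct sum of the interval modules of the bars of `A`: at scale `t` it has as a basis the
bars that contain `t`, and the map from scale `s` to scale `t` sends such a basis element to itself
if the bar still contains `t` and to `0` otherwise. -/
def intervalSum (F : Type*) [Field F] (A : Barcode) : PersistenceModule F where
  obj t := Finsupp.supported F F (liveBars A t)
  map {s t} _ := by
    classical
    exact (Finsupp.restrictDom F F (liveBars A t)).comp
      (Finsupp.supported F F (liveBars A s)).subtype
  map_refl t x := by
    classical
    ext1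
    exact Finsupp.filter_eq_self_iff _ _ |>.2 fun i hi =>
      (Finsupp.mem_supported F _).1 x.2 (by simpa using hi)
  map_map {s t u} hst htu x := by
    classical
    ext1
    ext i
    change (Finsupp.filter (· ∈ liveBars A u) (Finsupp.filter (· ∈ liveBars A t) x.1)) i
      = (Finsupp.filter (· ∈ liveBars A u) x.1) i
    by_cases hu : i ∈ liveBars A u
    · rw [Finsupp.filter_apply_pos _ _ hu, Finsupp.filter_apply_pos _ _ hu]
      by_cases ht : i ∈ liveBars A t
      · rw [Finsupp.filter_apply_pos _ _ ht]
      · rw [Finsupp.filter_apply_neg _ _ ht]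
        by_contra h0
        have hs : i ∈ liveBars A s :=
          (Finsupp.mem_supported F _).1 x.2 (by simpa using Ne.symm h0)
        exact ht ⟨hs.1.trans (by exact_mod_cast hst),
          lt_of_le_of_lt (by exact_mod_cast htu) hu.2⟩
    · rw [Finsupp.filter_apply_neg _ _ hu, Finsupp.filter_apply_neg _ _ hu]

/-- `A` is a barcode of `M`: the module `M` decomposes into the interval modules of `A`. -/
def HasBarcode (M : PersistenceModule F) (A : Barcode) : Prop :=
  Nonempty (Iso M (intervalSum F A))

/-- The barcode of `M`. For the modules used below (Vietoris-Rips persistent homology of a finite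
metric space, observed at a closed set of scales) it exists and is unique, by the
structure theorem for persistence modules. -/
def barcode (M : PersistenceModule F) : Barcode := Classical.epsilon M.HasBarcode

end PersistenceModule

/-! ### Simplicial homology -/

namespace PreAbstractSimplicialComplex

variable (F : Type*) [Field F] {V : Type*}

/-- The `F`-vector space with basis the `m`-tuples of elements of `V`: the ordered simplices with
`m` vertices, repetitions allowed. -/
def TupleChains (V : Type*) (m : ℕ) : Type _ := (Fin m → V) →₀ F

instance (V : Type*) (m : ℕ) : AddCommGroup (TupleChains F V m) :=
  inferInstanceAs (AddCommGroup ((Fin m → V) →₀ F))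

instance (V : Type*) (m : ℕ) : Module F (TupleChains F V m) :=
  inferInstanceAs (Module F ((Fin m → V) →₀ F))

/-- The basis element of the tuple `σ`. -/
def tuple {m : ℕ} (σ : Fin m → V) : TupleChains F V m := Finsupp.single σ 1

/-- The boundary map of the augmented ordered chain complex: a tuple with `m + 1` entries is sent to
the alternating sum of the tuples that omit one entry. For `m = 0` this is the augmentation, which
sends every vertex to the empty tuple. -/
def boundary (V : Type*) (m : ℕ) : TupleChains F V (m + 1) →ₗ[F] TupleChains F V m :=
  Finsupp.linearCombination F fun σ : Fin (m + 1) → V =>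
    ∑ i : Fin (m + 1), (-1 : F) ^ (i : ℕ) • tuple F (σ ∘ i.succAbove)

/-- The ordered `m`-chains of `K`, spanned by the tuples `(v₀, …, v_m)`, repetitions allowed, whose
vertices form a simplex of `K`. -/
def chains (K : PreAbstractSimplicialComplex V) (m : ℕ) : Submodule F (TupleChains F V (m + 1)) :=
  Submodule.span F {c | ∃ σ : Fin (m + 1) → V, (∃ s ∈ K, (s : Set V) = Set.range σ) ∧ c = tuple F σ}

/-- The `m`-cycles of `K` in the augmented ordered chain complex. -/
def cycles (K : PreAbstractSimplicialComplex V) (m : ℕ) : Submodule F (TupleChains F V (m + 1)) :=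
  chains F K m ⊓ LinearMap.ker (boundary F V m)

/-- The `m`-boundaries of `K`. -/
def boundaries (K : PreAbstractSimplicialComplex V) (m : ℕ) :
    Submodule F (TupleChains F V (m + 1)) :=
  (chains F K (m + 1)).map (boundary F V (m + 1))

/-- The reduced simplicial homology `H̃_m(K; F)`, computed by the augmented ordered chain complex.
For `m ≥ 1` this is the usual homology. -/
abbrev homology (K : PreAbstractSimplicialComplex V) (m : ℕ) : Type _ :=
  cycles F K m ⧸ (boundaries F K m).comap (cycles F K m).subtype

variable {F}

lemma chains_mono {K L : PreAbstractSimplicialComplex V} (h : K ≤ L) (m : ℕ) :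
    chains F K m ≤ chains F L m :=
  Submodule.span_mono fun _ ⟨σ, ⟨s, hs, e⟩, hc⟩ => ⟨σ, ⟨s, h hs, e⟩, hc⟩

lemma cycles_mono {K L : PreAbstractSimplicialComplex V} (h : K ≤ L) (m : ℕ) :
    cycles F K m ≤ cycles F L m :=
  inf_le_inf_right _ (chains_mono h m)

lemma boundaries_mono {K L : PreAbstractSimplicialComplex V} (h : K ≤ L) (m : ℕ) :
    boundaries F K m ≤ boundaries F L m :=
  Submodule.map_mono (chains_mono h (m + 1))

variable (F)

/-- The map in homology induced by an inclusion of simplicial complexes. -/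
def homologyMap {K L : PreAbstractSimplicialComplex V} (h : K ≤ L) (m : ℕ) :
    homology F K m →ₗ[F] homology F L m :=
  Submodule.mapQ _ _ (Submodule.inclusion (cycles_mono h m)) fun _ hx => boundaries_mono h m hx

/-- The persistent `m`-th homology of an increasing family of simplicial complexes. -/
def persistentHomology (K : ℝ≥0 → PreAbstractSimplicialComplex V) (hK : Monotone K) (m : ℕ) :
    PersistenceModule F where
  obj t := homology F (K t) m
  map h := homologyMap F (hK h) m
  map_refl t x := by
    obtain ⟨z, rfl⟩ := Submodule.Quotient.mk_surjective _ x
    rfl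
  map_map hst htu x := by
    obtain ⟨z, rfl⟩ := Submodule.Quotient.mk_surjective _ x
    rfl

end PreAbstractSimplicialComplex

/-! ### Vietoris-Rips persistent homology -/

/-- The Vietoris-Rips complex at scale `ε`. -/
def vietorisRips (X : Type*) [MetricSpace X] (ε : ℝ≥0) : PreAbstractSimplicialComplex X where
  faces := {s | s.Nonempty ∧ ∀ x ∈ s, ∀ y ∈ s, dist x y ≤ ε}
  isRelLowerSet_faces := fun _ hs =>
    ⟨hs.1, fun _ hts ht => ⟨ht, fun x hx y hy => hs.2 x (hts hx) y (hts hy)⟩⟩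

/-- The Vietoris-Rips filtration, observed at the scales in `S`. At scale `t` it is the
Vietoris-Rips complex at the last observed scale `s ≤ t` (empty if there is none); from the largest
element of `S` on, if there is one, it is the full simplex, so that all bars are cut off there.
For `S = [0, ∞)` this is the plain Vietoris-Rips filtration (see
`ripsFiltration_univ`), for `S = [0, T]` the one with cut-off at `T`, and for a finite set or a
sequence `S` the one that uses only these finitely or countably many scales. -/
def ripsFiltration (S : Set ℝ≥0) (X : Type*) [MetricSpace X] (t : ℝ≥0) :
    PreAbstractSimplicialComplex X where
  faces := {σ | σ.Nonempty ∧ ((∃ s ∈ S, s ≤ t ∧ σ ∈ vietorisRips X s) ∨ ∀ s ∈ S, s ≤ t)}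
  isRelLowerSet_faces := by
    rintro σ ⟨hne, h⟩
    refine ⟨hne, fun τ hτ hτne => ⟨hτne, h.imp_left ?_⟩⟩
    rintro ⟨s, hs, hst, hσ⟩
    exact ⟨s, hs, hst, ((vietorisRips X s).isRelLowerSet_faces hσ).2 hτ hτne⟩

lemma ripsFiltration_mono (S : Set ℝ≥0) (X : Type*) [MetricSpace X] :
    Monotone (ripsFiltration S X) := by
  rintro t u htu σ ⟨hne, h⟩
  refine ⟨hne, h.imp ?_ fun h s hs => (h s hs).trans htu⟩
  rintro ⟨s, hs, hst, hσ⟩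
  exact ⟨s, hs, hst.trans htu, hσ⟩

lemma ripsFiltration_univ (X : Type*) [MetricSpace X] (t : ℝ≥0) :
    ripsFiltration Set.univ X t = vietorisRips X t := by
  ext σ
  constructor
  · rintro ⟨hne, ⟨s, -, hst, hσ⟩ | h⟩
    · exact ⟨hne, fun x hx y hy => (hσ.2 x hx y hy).trans (by exact_mod_cast hst)⟩
    · have := h (t + 1) (Set.mem_univ _)
      exact absurd this (by simp)
  · exact fun hσ => ⟨hσ.1, Or.inl ⟨t, Set.mem_univ _, le_rfl, hσ⟩⟩

/-- `PH_k`: the barcode of the `k`-th (reduced) Vietoris-Rips persistent homology of a finite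
metric space, with coefficients in `F`, observed at the scales in `S`. -/
def ripsBarcode (F : Type*) [Field F] (S : Set ℝ≥0) (k : ℕ) (X : Type*) [MetricSpace X] : Barcode :=
  (PreAbstractSimplicialComplex.persistentHomology F (ripsFiltration S X)
    (ripsFiltration_mono S X) k).barcode

/-- `PH_k` of a sample `(x₁, …, x_n)` from `X`: that of the subspace `{x₁, …, x_n}` of `X`. -/
def sampleBarcode (F : Type*) [Field F] (S : Set ℝ≥0) (k : ℕ) {n : ℕ} {X : Type*} [MetricSpace X]
    (x : Fin n → X) : Barcode :=
  ripsBarcode F S k (Set.range x)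

/-! ### The invariants -/

/-- `Φ_k^n(X, μ)`: the push-forward of the product measure `μ^{⊗ n}` along `PH_k`. -/
def barcodeLaw (F : Type*) [Field F] (S : Set ℝ≥0) (k n : ℕ) {X : Type*} [MetricSpace X]
    [MeasurableSpace X] (μ : Measure X) : Measure Barcode :=
  (Measure.pi fun _ : Fin n => μ).map (sampleBarcode F S k)

/-- `Φ_k^n(X)` for a non-empty finite metric space `X` with its Borel sets and the uniform
probability measure, as a point of the space of Borel probability measures on the space of barcodes,
with the Prohorov metric. -/
def Phi (F : Type*) [Field F] (S : Set ℝ≥0) (k n : ℕ) (X : Type*) [MetricSpace X] [Finite X]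
    [Nonempty X] : LevyProkhorov (ProbabilityMeasure Barcode) :=
  letI : MeasurableSpace X := borel X
  haveI : BorelSpace X := ⟨rfl⟩
  LevyProkhorov.ofMeasure
    ⟨barcodeLaw F S k n (ProbabilityTheory.uniformOn (Set.univ : Set X)), by
      have := ProbabilityTheory.isProbabilityMeasure_uniformOn
        (Set.finite_univ (α := X)) Set.univ_nonempty
      exact Measure.isProbabilityMeasure_map (measurable_of_finite _).aemeasurable⟩

/-- `HD_k^n(X, P) = d_Pr(Φ_k^n(X), P)`. -/
def HD (F : Type*) [Field F] (S : Set ℝ≥0) (k n : ℕ) (P : ProbabilityMeasure Barcode)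
    (X : Type*) [MetricSpace X] [Finite X] [Nonempty X] : ℝ :=
  dist (Phi F S k n X) (LevyProkhorov.ofMeasure P)

/-- A function `f` from non-empty finite metric spaces to a metric space is uniformly robust with
robustness coefficient `r` and estimate bound `δ`. -/
def UniformlyRobust.{u, v} {B : Type v} [MetricSpace B]
    (f : ∀ (X : Type u) [MetricSpace X] [Finite X] [Nonempty X], B) (r δ : ℝ) : Prop :=
  ∀ (X X' : Type u) [MetricSpace X] [Finite X] [Nonempty X]
    [MetricSpace X'] [Finite X'] [Nonempty X'] (φ : X → X'), Isometry φ →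
    (Nat.card X' : ℝ) / Nat.card X < 1 + r → dist (f X) (f X') < δ

end

/-!
A sample from `X` is a sample from `X'` whose points happen to lie in `X`. Under `μ_{X'}^{⊗ n}` this
event has probability `q ^ n` with `q = |X| / |X'|`, and conditionally on it the sample is
distributed according to `μ_X^{⊗ n}`. The barcode of a sample depends only on its isometry type, so
`q ^ n • Φ(X) ≤ Φ(X')` as measures (`smul_barcodeLaw_le`). Two probability measures with this
property are at Prohorov distance at most `1 - q ^ n` (`levyProkhorovEDist_le_of_smul_le`), and
`1 - q ^ n ≤ n (1 - q) < n r / (1 + r)` by Bernoulli's inequality and `q > 1 / (1 + r)`. The claim on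
`HD` follows because the distance to a fixed point is `1`-Lipschitz.

For the isometry invariance (`ripsBarcode_eq_of_isometryEquiv`), an isometry carries one
Vietoris-Rips filtration to the other, hence induces an isomorphism of persistence modules; since
isomorphic modules have the same barcodes, the barcodes chosen for them agree.
-/

open MeasureTheory
open scoped NNReal ENNReal

noncomputable section

/-! ### Isomorphic persistence modules -/

namespace PersistenceModule

variable {F : Type*} [Field F]

/-- The inverse of an isomorphism of persistence modules. -/
def Iso.symm {M N : PersistenceModule F} (e : Iso M N) : Iso N M where
  equiv t := (e.equiv t).symm
  comm h x := by
    rw [LinearEquiv.symm_apply_eq, e.comm, LinearEquiv.apply_symm_apply]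

/-- The composition of isomorphisms of persistence modules. -/
def Iso.trans {M N P : PersistenceModule F} (e : Iso M N) (f : Iso N P) : Iso M P where
  equiv t := (e.equiv t).trans (f.equiv t)
  comm h x := by
    simp only [LinearEquiv.trans_apply, e.comm, f.comm]

lemma barcode_eq_of_iso {M N : PersistenceModule F} (e : Iso M N) : M.barcode = N.barcode := by
  have h : M.HasBarcode = N.HasBarcode := funext fun A => propext
    ⟨fun ⟨f⟩ => ⟨e.symm.trans f⟩, fun ⟨f⟩ => ⟨e.trans f⟩⟩
  rw [barcode, barcode, h]

end PersistenceModule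

/-! ### Homology of isomorphic simplicial complexes -/

namespace PreAbstractSimplicialComplex

variable (F : Type*) [Field F] {V W : Type*}

/-- The isomorphism of tuple chains induced by a bijection of the vertices. -/
def tupleEquiv (e : V ≃ W) (m : ℕ) : TupleChains F V m ≃ₗ[F] TupleChains F W m :=
  Finsupp.domLCongr ((Equiv.refl (Fin m)).arrowCongr e)

lemma tupleEquiv_tuple (e : V ≃ W) {m : ℕ} (σ : Fin m → V) :
    tupleEquiv F e m (tuple F σ) = tuple F (e ∘ σ) :=
  Finsupp.domLCongr_single _ _ _

lemma boundary_tuple {m : ℕ} (σ : Fin (m + 1) → V) :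
    boundary F V m (tuple F σ) =
      ∑ i : Fin (m + 1), (-1 : F) ^ (i : ℕ) • tuple F (σ ∘ i.succAbove) := by
  rw [boundary, tuple]
  exact (Finsupp.linearCombination_single _ _ _).trans (one_smul _ _)

lemma boundary_comp_tupleEquiv (e : V ≃ W) (m : ℕ) :
    boundary F W m ∘ₗ (tupleEquiv F e (m + 1) : TupleChains F V (m + 1) →ₗ[F] _) =
      (tupleEquiv F e m : TupleChains F V m →ₗ[F] _) ∘ₗ boundary F V m := by
  refine Finsupp.lhom_ext' fun σ => LinearMap.ext_ring ?_
  change boundary F W m (tupleEquiv F e (m + 1) (tuple F σ)) =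
    tupleEquiv F e m (boundary F V m (tuple F σ))
  simp only [tupleEquiv_tuple, boundary_tuple, map_sum, map_smul, Function.comp_assoc]

variable {K : PreAbstractSimplicialComplex V} {L : PreAbstractSimplicialComplex W}

lemma map_chains (e : V ≃ W) (h : ∀ s, s ∈ K ↔ s.map e.toEmbedding ∈ L) (m : ℕ) :
    (chains F K m).map (tupleEquiv F e (m + 1) : TupleChains F V (m + 1) →ₗ[F] _) =
      chains F L m := by
  rw [chains, chains, Submodule.map_span]
  congr 1
  ext c
  constructor
  · rintro ⟨_, ⟨σ, ⟨s, hs, e'⟩, rfl⟩, rfl⟩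
    refine ⟨e ∘ σ, ⟨s.map e.toEmbedding, (h s).1 hs, ?_⟩, tupleEquiv_tuple F e σ⟩
    rw [Finset.coe_map, e', Set.range_comp]; rfl
  · rintro ⟨σ, ⟨s, hs, e'⟩, rfl⟩
    refine ⟨_, ⟨e.symm ∘ σ, ⟨s.map e.symm.toEmbedding, (h _).2 ?_, ?_⟩, rfl⟩, ?_⟩
    · rw [Finset.map_map]
      convert hs
      ext; simp
    · rw [Finset.coe_map, e', Set.range_comp]; rfl
    · refine (tupleEquiv_tuple F e _).trans ?_
      rw [← Function.comp_assoc, Equiv.self_comp_symm, Function.id_comp]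

lemma map_cycles (e : V ≃ W) (h : ∀ s, s ∈ K ↔ s.map e.toEmbedding ∈ L) (m : ℕ) :
    (cycles F K m).map (tupleEquiv F e (m + 1) : TupleChains F V (m + 1) →ₗ[F] _) =
      cycles F L m := by
  rw [cycles, cycles, Submodule.map_inf _ (tupleEquiv F e (m + 1)).injective, map_chains F e h]
  congr 1
  ext c
  have hc : boundary F W m c =
      tupleEquiv F e m (boundary F V m ((tupleEquiv F e (m + 1)).symm c)) := by
    simpa using LinearMap.congr_fun (boundary_comp_tupleEquiv F e m)
      ((tupleEquiv F e (m + 1)).symm c)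
  rw [Submodule.mem_map_equiv, LinearMap.mem_ker, LinearMap.mem_ker, hc,
    LinearEquiv.map_eq_zero_iff]

lemma map_boundaries (e : V ≃ W) (h : ∀ s, s ∈ K ↔ s.map e.toEmbedding ∈ L) (m : ℕ) :
    (boundaries F K m).map (tupleEquiv F e (m + 1) : TupleChains F V (m + 1) →ₗ[F] _) =
      boundaries F L m := by
  rw [boundaries, boundaries, ← Submodule.map_comp, ← boundary_comp_tupleEquiv,
    Submodule.map_comp, map_chains F e h]

/-- The isomorphism of cycle spaces induced by an isomorphism of simplicial complexes. -/
def cyclesEquiv (e : V ≃ W) (h : ∀ s, s ∈ K ↔ s.map e.toEmbedding ∈ L) (m : ℕ) :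
    cycles F K m ≃ₗ[F] cycles F L m :=
  (tupleEquiv F e (m + 1)).ofSubmodules _ _ (map_cycles F e h m)

/-- The isomorphism in homology induced by an isomorphism of simplicial complexes. -/
def homologyEquiv (e : V ≃ W) (h : ∀ s, s ∈ K ↔ s.map e.toEmbedding ∈ L) (m : ℕ) :
    homology F K m ≃ₗ[F] homology F L m :=
  Submodule.Quotient.equiv _ _ (cyclesEquiv F e h m) <| by
    ext z
    rw [Submodule.mem_map_equiv, Submodule.mem_comap, Submodule.mem_comap, ← map_boundaries F e h,
      Submodule.mem_map_equiv]
    rfl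

/-- The isomorphism of persistent homology induced by an isomorphism of filtered complexes. -/
def persistentHomologyIso {K : ℝ≥0 → PreAbstractSimplicialComplex V} (hK : Monotone K)
    {L : ℝ≥0 → PreAbstractSimplicialComplex W} (hL : Monotone L) (e : V ≃ W)
    (h : ∀ t s, s ∈ K t ↔ s.map e.toEmbedding ∈ L t) (m : ℕ) :
    PersistenceModule.Iso (persistentHomology F K hK m) (persistentHomology F L hL m) where
  equiv t := homologyEquiv F e (h t) m
  comm _ x := by
    obtain ⟨z, rfl⟩ := Submodule.Quotient.mk_surjective _ x
    rfl

end PreAbstractSimplicialComplex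

/-! ### Isometry invariance of the barcode -/

section Isometry

variable {X Y : Type*} [MetricSpace X] [MetricSpace Y]

lemma mem_vietorisRips_map_iff (e : X ≃ᵢ Y) (ε : ℝ≥0) (s : Finset X) :
    s ∈ vietorisRips X ε ↔ s.map e.toEquiv.toEmbedding ∈ vietorisRips Y ε := by
  change (s.Nonempty ∧ _) ↔ ((s.map e.toEquiv.toEmbedding).Nonempty ∧ _)
  simp only [Finset.map_nonempty, Finset.forall_mem_map, Equiv.coe_toEmbedding,
    IsometryEquiv.coe_toEquiv, e.dist_eq]

lemma mem_ripsFiltration_map_iff (S : Set ℝ≥0) (e : X ≃ᵢ Y) (t : ℝ≥0) (s : Finset X) :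
    s ∈ ripsFiltration S X t ↔ s.map e.toEquiv.toEmbedding ∈ ripsFiltration S Y t := by
  change (s.Nonempty ∧ _) ↔ ((s.map e.toEquiv.toEmbedding).Nonempty ∧ _)
  simp only [Finset.map_nonempty, mem_vietorisRips_map_iff e]

theorem ripsBarcode_eq_of_isometryEquiv (F : Type*) [Field F] (S : Set ℝ≥0) (k : ℕ)
    (e : X ≃ᵢ Y) : ripsBarcode F S k X = ripsBarcode F S k Y :=
  PersistenceModule.barcode_eq_of_iso
    (PreAbstractSimplicialComplex.persistentHomologyIso F _ _ e.toEquiv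
      (mem_ripsFiltration_map_iff S e) k)

lemma sampleBarcode_comp_isometry (F : Type*) [Field F] (S : Set ℝ≥0) (k : ℕ) {n : ℕ} {φ : X → Y}
    (hφ : Isometry φ) (x : Fin n → X) :
    sampleBarcode F S k (φ ∘ x) = sampleBarcode F S k x := by
  let g : Set.range x → Set.range (φ ∘ x) := fun y =>
    ⟨φ y, by obtain ⟨_, i, rfl⟩ := y; exact ⟨i, rfl⟩⟩
  have hg : Isometry g := fun y z => hφ y z
  have hs : Function.Surjective g := by
    rintro ⟨_, i, rfl⟩
    exact ⟨⟨x i, i, rfl⟩, rfl⟩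
  exact (ripsBarcode_eq_of_isometryEquiv F S k
    (IsometryEquiv.mk (Equiv.ofBijective g ⟨hg.injective, hs⟩) hg)).symm

end Isometry

/-! ### Laws of samples -/

open ProbabilityTheory in
lemma pi_uniformOn_univ {n : ℕ} {X : Type*} [Finite X] [Nonempty X] [MeasurableSpace X]
    [MeasurableSingletonClass X] :
    Measure.pi (fun _ : Fin n => uniformOn (Set.univ : Set X)) =
      ((Nat.card X : ℝ≥0∞) ^ n)⁻¹ • Measure.count := by
  have := Fintype.ofFinite X
  have := isProbabilityMeasure_uniformOn (Set.finite_univ (α := X)) Set.univ_nonempty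
  refine Measure.ext_of_singleton fun x => ?_
  rw [Measure.pi_singleton]
  simp [uniformOn_univ, ENNReal.inv_pow]

/-- Samples from `X`, viewed in `X'` along an isometric embedding, are among the samples from `X'`
and have the same barcodes. -/
lemma smul_barcodeLaw_le (F : Type*) [Field F] (S : Set ℝ≥0) (k n : ℕ) {X X' : Type*}
    [MetricSpace X] [Finite X] [Nonempty X] [MeasurableSpace X] [MeasurableSingletonClass X]
    [MetricSpace X'] [Finite X'] [Nonempty X'] [MeasurableSpace X'] [MeasurableSingletonClass X']
    {φ : X → X'} (hφ : Isometry φ) :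
    ((Nat.card X : ℝ≥0∞) / Nat.card X') ^ n •
        barcodeLaw F S k n (ProbabilityTheory.uniformOn (Set.univ : Set X)) ≤
      barcodeLaw F S k n (ProbabilityTheory.uniformOn (Set.univ : Set X')) := by
  refine Measure.le_iff.2 fun B hB => ?_
  have h0 : (Nat.card X : ℝ≥0∞) ^ n ≠ 0 :=
    pow_ne_zero _ (Nat.cast_ne_zero.2 Nat.card_pos.ne')
  have ht : (Nat.card X : ℝ≥0∞) ^ n ≠ ∞ := by simp
  have hinj : Function.Injective fun x : Fin n → X => φ ∘ x := hφ.injective.comp_left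
  rw [Measure.smul_apply, barcodeLaw, barcodeLaw, Measure.map_apply (measurable_of_finite _) hB,
    Measure.map_apply (measurable_of_finite _) hB, pi_uniformOn_univ, pi_uniformOn_univ,
    Measure.smul_apply, Measure.smul_apply, smul_eq_mul, smul_eq_mul, smul_eq_mul,
    ← Measure.count_injective_image hinj, div_eq_mul_inv, mul_pow, ← ENNReal.inv_pow,
    ← mul_assoc, mul_right_comm ((Nat.card X : ℝ≥0∞) ^ n), ENNReal.mul_inv_cancel h0 ht, one_mul]
  gcongr
  rintro _ ⟨x, hx, rfl⟩
  rw [Set.mem_preimage, sampleBarcode_comp_isometry F S k hφ]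
  exact hx

/-! ### The Prohorov estimate -/

/-- If `ν` has a part `q • μ`, then `μ` and `ν` differ by at most `1 - q` on every set. For
probability measures the one-sided comparison already bounds the Prohorov distance. -/
lemma levyProkhorovEDist_le_of_smul_le {Ω : Type*} [MeasurableSpace Ω] [PseudoEMetricSpace Ω]
    [OpensMeasurableSpace Ω] {μ ν : Measure Ω} [IsProbabilityMeasure μ] [IsProbabilityMeasure ν]
    {q : ℝ≥0∞} (h : q • μ ≤ ν) : levyProkhorovEDist μ ν ≤ 1 - q := by
  refine levyProkhorovEDist_le_of_forall_le μ ν _ fun ε B hε _ _ => ?_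
  have hB : B ⊆ Metric.thickening ε.toReal B :=
    Metric.self_subset_thickening (ENNReal.toReal_pos (bot_lt_of_lt hε).ne' ‹ε < ∞›.ne) B
  calc μ B = 1 * μ B := (one_mul _).symm
    _ ≤ (q + (1 - q)) * μ B := by gcongr; exact le_add_tsub
    _ = q * μ B + (1 - q) * μ B := add_mul _ _ _
    _ ≤ ν (Metric.thickening ε.toReal B) + ε * 1 := by
      gcongr
      · exact (h B).trans (measure_mono hB)
      · exact prob_le_one
    _ = _ := by rw [mul_one]

lemma dist_Phi_le (F : Type*) [Field F] (S : Set ℝ≥0) (k n : ℕ) {X X' : Type*}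
    [MetricSpace X] [Finite X] [Nonempty X] [MetricSpace X'] [Finite X'] [Nonempty X']
    {φ : X → X'} (hφ : Isometry φ) :
    dist (Phi F S k n X) (Phi F S k n X') ≤ 1 - ((Nat.card X : ℝ) / Nat.card X') ^ n := by
  let : MeasurableSpace X := borel X
  have : BorelSpace X := ⟨rfl⟩
  let : MeasurableSpace X' := borel X'
  have : BorelSpace X' := ⟨rfl⟩
  have hcard : (Nat.card X : ℝ) ≤ Nat.card X' := by
    exact_mod_cast Nat.card_le_card_of_injective φ hφ.injective
  have hq1 : (Nat.card X : ℝ) / Nat.card X' ≤ 1 := div_le_one_of_le₀ hcard (by positivity)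
  have hq : ((Nat.card X : ℝ≥0∞) / Nat.card X') ^ n =
      ENNReal.ofReal (((Nat.card X : ℝ) / Nat.card X') ^ n) := by
    rw [ENNReal.ofReal_pow (by positivity),
      ENNReal.ofReal_div_of_pos (by exact_mod_cast Nat.card_pos), ENNReal.ofReal_natCast, ENNReal.ofReal_natCast]
  have h := levyProkhorovEDist_le_of_smul_le (μ := (Phi F S k n X).toMeasure.toMeasure)
    (ν := (Phi F S k n X').toMeasure.toMeasure) (smul_barcodeLaw_le F S k n hφ)
  rw [hq, ← ENNReal.ofReal_one, ← ENNReal.ofReal_sub _ (by positivity)] at h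
  rw [LevyProkhorov.dist_probabilityMeasure_def]
  exact ENNReal.toReal_le_of_le_ofReal (sub_nonneg.2 (pow_le_one₀ (by positivity) hq1)) h

theorem uniformlyRobust_Phi (F : Type*) [Field F] (S : Set ℝ≥0) (k n : ℕ) (hn : 1 ≤ n)
    (r : ℝ) (hr : 0 < r) :
    UniformlyRobust (fun (X : Type*) [MetricSpace X] [Finite X] [Nonempty X] => Phi F S k n X)
      r (n * r / (1 + r)) := by
  intro X X' _ _ _ _ _ _ φ hφ hX
  refine (dist_Phi_le F S k n hφ).trans_lt ?_
  have hx : (0 : ℝ) < Nat.card X := by exact_mod_cast Nat.card_pos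
  have hx' : (0 : ℝ) < Nat.card X' := by exact_mod_cast Nat.card_pos
  set q : ℝ := (Nat.card X : ℝ) / Nat.card X' with hq
  have hq0 : 0 < q := div_pos hx hx'
  have hqr : 1 / (1 + r) < q := by
    rw [← inv_div] at hX
    rw [one_div]
    exact inv_lt_of_inv_lt₀ hq0 hX
  have hbern := one_add_mul_le_pow (a := q - 1) (by linarith) n
  rw [add_sub_cancel] at hbern
  have hn' : (0 : ℝ) < n := by exact_mod_cast hn
  calc 1 - q ^ n ≤ n * (1 - q) := by linarith
    _ < n * (1 - 1 / (1 + r)) := by gcongr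
    _ = n * r / (1 + r) := by field_simp; ring

end

theorem theorem1p6 (F : Type*) [Field F] (S : Set ℝ≥0) (hS : IsClosed S) (k n : ℕ) (hn : 1 ≤ n)
    (r : ℝ) (hr : 0 < r) :
    UniformlyRobust (fun (X : Type*) [MetricSpace X] [Finite X] [Nonempty X] => Phi F S k n X)
      r (n * r / (1 + r)) ∧
    ∀ P : ProbabilityMeasure Barcode,
      UniformlyRobust (fun (X : Type*) [MetricSpace X] [Finite X] [Nonempty X] => HD F S k n P X)
        r (n * r / (1 + r)) := by
  refine ⟨uniformlyRobust_Phi F S k n hn r hr, fun P X X' _ _ _ _ _ _ φ hφ hX => ?_⟩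
  exact (dist_dist_dist_le_left _ _ _).trans_lt
    (uniformlyRobust_Phi F S k n hn r hr X X' φ hφ hX)
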